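/- \textbf{Definitions.} Let $A$ be a separable C*-algebra and let $X=\mathrm{Prim}(A)$ be its primitive spectrum, i.e. the set of kernels of irreducible representations of $A$ with the Jacobson topology, whose closed sets are the sets $\mathrm{hull}(I)=\{P\in X: I\subseteq P\}$ for $I$ an ideal of $A$. For $a\in A$ let $w_a:X\to\mathbb{N}\cup\{\infty\}$, $w_a(\mathrm{Ker}\,\rho)=\mathrm{rank}(\rho(a))$ (this depends only on $\mathrm{Ker}\,\rho$). For a topological space $X$ and a function $w:X\to\mathbb{N}\cup\{\infty\}$, the order $o_w(x)$ of $x\in X$ is defined recursively as follows: for an ordinal $\alpha$, one has $o_w(x)\le\alpha$ if and only if there are a neighborhood $U$ of $x$ and $N\in\mathbb{N}$ such that every $y\in U$ satisfies $o_w(y)<\alpha$ or $w(y)\le N$. Then $o_w(x)$ is the least such $\alpha$, and $o_w(x)=\infty$ if there is none (in particular if $w(x)=\infty$). The rank of $x$ is $r_w(x)=\omega\cdot o_w(x)+w(x)$ if $o_w(x)\neq\infty$, and $r_w(x)=\infty$ otherwise. The rank of $w$ is $r(w)=\sup_{x\in X}r_w(x)$, an ordinal or $\infty$. The \emph{Pedersen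 rank} of $a\in A$ is $r_P(a):=r(w_a)$, and the \emph{Pedersen rank} of $A$ is $r_P(A):=\sup_{a\in A}r_P(a)$. \textbf{Proposition.} Let $A$ be a separable C*-algebra, let $x\in A$, and let $B=\overline{x^{*}Ax}$ be the hereditary C*-subalgebra of $A$ generated by $x$. Then the Pedersen rank of $x$ (computed in $A$) is equal to the Pedersen rank of the C*-algebra $B$: $$r_P(x)=r_P(B).$$ -/

import Mathlib

open scoped Topology

universe u

/-! ### Irreducible representations and the primitive spectrum -/

/-- A (topologically) irreducible representation of a C*-algebra `A` on a complex Hilbert space: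
a nonzero star-homomorphism `A → B(H)` without nontrivial closed invariant subspaces.
Such a representation is cyclic, so up to unitary equivalence `H` lives in the universe of `A`. -/
structure IrrRep (A : Type u) [NonUnitalCStarAlgebra A] where
  H : Type u
  [instNormed : NormedAddCommGroup H]
  [instInner : InnerProductSpace ℂ H]
  [instComplete : CompleteSpace H]
  toHom : A →⋆ₙₐ[ℂ] (H →L[ℂ] H)
  nonzero : ∃ a, toHom a ≠ 0
  irreducible : ∀ K : Submodule ℂ H, IsClosed (K : Set H) →
    (∀ a, ∀ v ∈ K, toHom a v ∈ K) → K = ⊥ ∨ K = ⊤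

attribute [instance] IrrRep.instNormed IrrRep.instInner IrrRep.instComplete

namespace IrrRep

variable {A : Type u} [NonUnitalCStarAlgebra A]

/-- The kernel of an irreducible representation. -/
noncomputable def ker (ρ : IrrRep A) : TwoSidedIdeal A := TwoSidedIdeal.ker ρ.toHom

theorem mem_ker (ρ : IrrRep A) (a : A) : a ∈ ρ.ker ↔ ρ.toHom a = 0 :=
  TwoSidedIdeal.mem_ker _

/-- The rank of the operator `ρ(a)`, an element of `{0, 1, 2, …, ∞}`. -/
noncomputable def rankOf (ρ : IrrRep A) (a : A) : ℕ∞ :=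
  Cardinal.toENat (LinearMap.rank (ρ.toHom a).toLinearMap)

/-- No nonzero vector is annihilated by the whole algebra. -/
theorem eq_zero_of_forall (ρ : IrrRep A) {v : ρ.H} (hv : ∀ a, ρ.toHom a v = 0) : v = 0 := by
  by_contra hne
  have hcl : IsClosed ((Submodule.span ℂ {v} : Submodule ℂ ρ.H) : Set ρ.H) :=
    Submodule.closed_of_finiteDimensional _
  have hz : ∀ a, ∀ y ∈ Submodule.span ℂ {v}, ρ.toHom a y = 0 := by
    intro a y hy
    obtain ⟨c, rfl⟩ := Submodule.mem_span_singleton.1 hy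
    simp [hv a]
  rcases ρ.irreducible _ hcl (fun a y hy => by rw [hz a y hy]; exact Submodule.zero_mem _) with h | h
  · exact hne (by simpa using h)
  · obtain ⟨a, ha⟩ := ρ.nonzero
    refine ha (ContinuousLinearMap.ext fun y => ?_)
    exact hz a y (h ▸ Submodule.mem_top)

/-- Primitive ideals are prime. -/
theorem prime (ρ : IrrRep A) {s t : A} (h : ∀ a, s * a * t ∈ ρ.ker) : s ∈ ρ.ker ∨ t ∈ ρ.ker := by
  by_contra! hcon
  obtain ⟨hs, ht⟩ := hcon
  rw [mem_ker] at hs ht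
  refine ht (ContinuousLinearMap.ext fun ξ => ?_)
  refine ρ.eq_zero_of_forall fun b => ?_
  let K : Submodule ℂ ρ.H :=
    { carrier := {y | ∀ c, ρ.toHom s (ρ.toHom c y) = 0 ∧ ρ.toHom s y = 0}
      zero_mem' := by simp
      add_mem' := by
        intro y z hy hz c
        simp [(hy c).1, (hy c).2, (hz c).1, (hz c).2]
      smul_mem' := by
        intro r y hy c
        simp [(hy c).1, (hy c).2] }
  have hK : IsClosed (K : Set ρ.H) := by
    have : (K : Set ρ.H) = ⋂ c, ({y | ρ.toHom s (ρ.toHom c y) = 0} ∩ {y | ρ.toHom s y = 0}) := by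
      ext y
      simp only [Set.mem_iInter]
      exact Iff.rfl
    rw [this]
    refine isClosed_iInter fun c => IsClosed.inter ?_ ?_
    · exact isClosed_eq (by fun_prop) continuous_const
    · exact isClosed_eq (by fun_prop) continuous_const
  have hinv : ∀ a, ∀ v ∈ K, ρ.toHom a v ∈ K := by
    intro a v hv c
    refine ⟨?_, (hv a).1⟩
    have := (hv (c * a)).1
    rwa [map_mul] at this
  have hmem : ρ.toHom b (ρ.toHom t ξ) ∈ K := by
    have key : ∀ a, ρ.toHom s (ρ.toHom a (ρ.toHom t ξ)) = 0 := by
      intro a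
      have h1 := (ρ.mem_ker _).1 (h a)
      rw [map_mul, map_mul] at h1
      exact congrArg (fun T : ρ.H →L[ℂ] ρ.H => T ξ) h1
    intro c
    refine ⟨?_, key b⟩
    have := key (c * b)
    rwa [map_mul] at this
  rcases ρ.irreducible K hK hinv with h0 | h1
  · simpa [h0] using hmem
  · refine absurd (ContinuousLinearMap.ext fun y => ?_) hs
    have hy : y ∈ K := h1 ▸ Submodule.mem_top
    exact (hy 0).2

end IrrRep

/-- The primitive spectrum of `A`: the set of kernels of irreducible representations of `A`. -/
def PrimSpec (A : Type u) [NonUnitalCStarAlgebra A] : Type u :=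
  {P : TwoSidedIdeal A // ∃ ρ : IrrRep A, ρ.ker = P}

namespace PrimSpec

variable {A : Type u} [NonUnitalCStarAlgebra A]

/-- The hull of an ideal: the set of all primitive ideals that contain it. -/
def hull (I : TwoSidedIdeal A) : Set (PrimSpec A) := {P | I ≤ P.1}

/-- The Jacobson (hull-kernel) topology: the closed sets are the hulls of ideals of `A`. (As
primitive ideals are closed, an ideal and its norm closure have the same hull.) -/
instance : TopologicalSpace (PrimSpec A) :=
  TopologicalSpace.ofClosed {C | ∃ I : TwoSidedIdeal A, C = hull I}
    (by
      refine ⟨⊤, ?_⟩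
      ext P
      obtain ⟨ρ, hρ⟩ := P.2
      simp only [Set.mem_empty_iff_false, hull, Set.mem_ofPred_eq, false_iff]
      intro h
      obtain ⟨a, ha⟩ := ρ.nonzero
      refine ha ((ρ.mem_ker a).1 ?_)
      rw [hρ]
      exact h trivial)
    (by
      intro S hS
      refine ⟨sSup {I | hull I ∈ S}, ?_⟩
      ext P
      simp only [Set.mem_sInter, hull, Set.mem_ofPred_eq, sSup_le_iff]
      constructor
      · intro h I hI
        exact h _ hI
      · intro h C hC
        obtain ⟨I, rfl⟩ := hS hC
        exact h I hC)
    (by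
      rintro _ ⟨I, rfl⟩ _ ⟨J, rfl⟩
      refine ⟨I ⊓ J, ?_⟩
      ext P
      constructor
      · rintro (h | h)
        · exact le_trans (a := I ⊓ J) inf_le_left (show I ≤ P.1 from h)
        · exact le_trans (a := I ⊓ J) inf_le_right (show J ≤ P.1 from h)
      · intro h
        obtain ⟨ρ, hρ⟩ := P.2
        by_contra hcon
        simp only [hull, Set.mem_union, Set.mem_ofPred_eq, not_or] at hcon
        obtain ⟨hI, hJ⟩ := hcon
        rw [SetLike.not_le_iff_exists] at hI hJ
        obtain ⟨s, hsI, hs⟩ := hI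
        obtain ⟨t, htJ, ht⟩ := hJ
        rw [← hρ] at hs ht
        have : ∀ a, s * a * t ∈ ρ.ker := by
          intro a
          rw [hρ]
          apply h
          rw [TwoSidedIdeal.mem_inf]
          exact ⟨I.mul_mem_right _ _ (I.mul_mem_right _ _ hsI), J.mul_mem_left _ _ htJ⟩
        rcases ρ.prime this with h1 | h1
        · exact hs h1
        · exact ht h1)

end PrimSpec

/-! ### Order and rank of a function with values in `{0, 1, 2, …, ∞}` -/

section Weight

variable {X : Type u} [TopologicalSpace X]

/-- `OrderLE w α x` says that the order of `x` with respect to `w` is at most `α`: on some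
neighbourhood of `x`, the function `w` is bounded by a natural number off the set of points of
order less than `α`. For `α = 0` this says that `w` is bounded on a neighbourhood of `x`. If
`w x = ∞` then `OrderLE w α x` fails for all `α`. -/
def OrderLE (w : X → ℕ∞) (α : Ordinal.{u}) (x : X) : Prop :=
  ∃ U ∈ 𝓝 x, ∃ N : ℕ, ∀ y ∈ U, (∃ β, ∃ _ : β < α, OrderLE w β y) ∨ w y ≤ N
termination_by α

/-- The order of `x` with respect to `w`: the least `α` with `OrderLE w α x`, and `∞` (that is,
`⊤`) if there is no such ordinal. -/
noncomputable def weightOrder (w : X → ℕ∞) (x : X) : WithTop Ordinal.{u} :=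
  ⨅ (α : Ordinal.{u}) (_ : OrderLE w α x), (α : WithTop Ordinal.{u})

/-- The rank `ω · α + w x` of a point `x` of order `α`; it is `∞` if the order is `∞`. (A point of
order `α ≠ ∞` has `w x ≠ ∞`.) -/
noncomputable def weightRankAt (w : X → ℕ∞) (x : X) : WithTop Ordinal.{u} :=
  WithTop.map (fun α : Ordinal.{u} => Ordinal.omega0 * α + ((w x).toNat : Ordinal.{u}))
    (weightOrder w x)

/-- The rank of `w`: the supremum of the ranks of the points of `X`. -/
noncomputable def weightRank (w : X → ℕ∞) : WithTop Ordinal.{u} :=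
  ⨆ x : X, weightRankAt w x

end Weight

/-! ### The Pedersen rank -/

section Pedersen

variable {A : Type u} [NonUnitalCStarAlgebra A]

/-- The Pedersen function of `a`, which sends `Ker ρ` to the rank of `ρ(a)`. This rank depends on
the kernel of `ρ` only; the supremum over all `ρ` with the given kernel avoids a choice of `ρ`. -/
noncomputable def pedersenFunction (a : A) (P : PrimSpec A) : ℕ∞ :=
  ⨆ (ρ : IrrRep A) (_ : ρ.ker = P.1), ρ.rankOf a

/-- The Pedersen rank of an element. -/
noncomputable def elementPedersenRank (a : A) : WithTop Ordinal.{u} :=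
  weightRank (pedersenFunction a)

variable (A) in
/-- The Pedersen rank of a C*-algebra: the supremum of the Pedersen ranks of its elements. -/
noncomputable def algebraPedersenRank : WithTop Ordinal.{u} :=
  ⨆ a : A, elementPedersenRank a

/-- The star-subalgebra `x* A x`. -/
def cornerSubalgebra (x : A) : NonUnitalStarSubalgebra ℂ A where
  carrier := {b | ∃ a, b = star x * a * x}
  zero_mem' := ⟨0, by simp⟩
  add_mem' := by
    rintro _ _ ⟨a, rfl⟩ ⟨b, rfl⟩
    exact ⟨a + b, by rw [mul_add, add_mul]⟩
  mul_mem' := by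
    rintro _ _ ⟨a, rfl⟩ ⟨b, rfl⟩
    exact ⟨a * x * star x * b, by simp only [mul_assoc]⟩
  smul_mem' := by
    rintro c _ ⟨a, rfl⟩
    exact ⟨c • a, by rw [mul_smul_comm, smul_mul_assoc]⟩
  star_mem' := by
    rintro _ ⟨a, rfl⟩
    exact ⟨star a, by simp only [star_mul, star_star, mul_assoc]⟩

/-- The hereditary C*-subalgebra of `A` generated by `x`: the norm closure of `x* A x`. -/
def hereditarySubalgebra (x : A) : NonUnitalStarSubalgebra ℂ A :=
  (cornerSubalgebra x).topologicalClosure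

noncomputable instance (x : A) : NonUnitalCStarAlgebra (hereditarySubalgebra x) :=
  haveI : IsClosed (hereditarySubalgebra x : Set A) :=
    NonUnitalStarSubalgebra.isClosed_topologicalClosure _
  NonUnitalStarSubalgebra.nonUnitalCStarAlgebra (hereditarySubalgebra x)

end Pedersen

/-!
Let `B` be the hereditary subalgebra generated by `x`. The proof identifies `Prim(B)` with the open
subset `{P | x ∉ P}` of `Prim(A)` in such a way that the Pedersen function of `b ∈ B`, computed in
`B`, is the restriction of its Pedersen function computed in `A`.

Irreducible representations correspond as follows. If `ρ` is an irreducible representation of `A`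
with `ρ(x) ≠ 0`, then `B` acts irreducibly on the closure of `ρ(x*) H`, which is the orthogonal
complement of the kernel of `ρ(x)`; no rank is lost, since `ρ(b)` vanishes on that kernel
(`IrrRep.restrict`). Conversely, given an irreducible representation `σ` of `B` and a vector
`ξ ≠ 0`, the functional `a ↦ ⟪ξ, σ(x* a x) ξ⟫` on `A` is positive, and its GNS representation is
irreducible and contains `σ` on `B` (`IrrRep.exists_extension`). As primitive ideals are prime, a
primitive ideal `P` with `x ∉ P` is determined by `P ∩ B`, and the resulting map
`Prim(B) → Prim(A)` is an open embedding (`PrimSpec.isOpenEmbedding_extend`).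

In every representation the kernel of `x` is contained in the kernel of each `b ∈ B`, with equality
for `b = (x* x)²`. So the Pedersen functions of elements of `B` are at most that of `x`, and one of
them agrees with it. The rank of a weight is monotone, which gives the two inequalities, apart from
the primitive ideals that contain `x`: their weight is zero, but their order may be positive. A
point of zero weight and order `α > 0` is, for each `β < α`, a limit of points of order at least `β`
and arbitrarily large weight, so that its rank `ω · α` does not exceed the supremum of the ranks of
points in the support (`Topology.IsOpenEmbedding.weightRank_comp`).
-/

open scoped CStarAlgebra InnerProductSpace

/-! ### Order and rank of weights on topological spaces -/

section Weight

variable {X Y : Type u} [TopologicalSpace X] [TopologicalSpace Y]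

theorem orderLE_iff {w : X → ℕ∞} {α : Ordinal.{u}} {x : X} :
    OrderLE w α x ↔ ∃ U ∈ 𝓝 x, ∃ N : ℕ, ∀ y ∈ U, (∃ β < α, OrderLE w β y) ∨ w y ≤ N := by
  rw [OrderLE]
  simp only [exists_prop]

theorem OrderLE.mono {w : X → ℕ∞} {α β : Ordinal.{u}} (hαβ : α ≤ β) {x : X}
    (h : OrderLE w α x) : OrderLE w β x := by
  obtain ⟨U, hU, N, h⟩ := orderLE_iff.1 h
  refine orderLE_iff.2 ⟨U, hU, N, fun y hy => (h y hy).imp_left ?_⟩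
  rintro ⟨γ, hγ, h'⟩
  exact ⟨γ, hγ.trans_le hαβ, h'⟩

theorem OrderLE.of_le {w w' : X → ℕ∞} (hw : w ≤ w') {α : Ordinal.{u}} :
    ∀ {x : X}, OrderLE w' α x → OrderLE w α x := by
  induction α using WellFoundedLT.induction with
  | ind α ih =>
    intro x h
    obtain ⟨U, hU, N, h⟩ := orderLE_iff.1 h
    refine orderLE_iff.2 ⟨U, hU, N, fun y hy => (h y hy).imp ?_ (hw y).trans⟩
    rintro ⟨γ, hγ, h'⟩
    exact ⟨γ, hγ, ih γ hγ h'⟩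

theorem OrderLE.ne_top {w : X → ℕ∞} {α : Ordinal.{u}} :
    ∀ {x : X}, OrderLE w α x → w x ≠ ⊤ := by
  induction α using WellFoundedLT.induction with
  | ind α ih =>
    intro x h
    obtain ⟨U, hU, N, h⟩ := orderLE_iff.1 h
    rcases h x (mem_of_mem_nhds hU) with ⟨γ, hγ, h'⟩ | h'
    · exact ih γ hγ h'
    · exact ne_top_of_le_ne_top (ENat.natCast_ne_top N) h'

theorem Topology.IsOpenEmbedding.orderLE_comp_iff {Ψ : Y → X} (hΨ : IsOpenEmbedding Ψ)
    (w : X → ℕ∞) (α : Ordinal.{u}) : ∀ y, OrderLE (w ∘ Ψ) α y ↔ OrderLE w α (Ψ y) := by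
  induction α using WellFoundedLT.induction with
  | ind α ih =>
    intro y
    rw [orderLE_iff, orderLE_iff]
    constructor
    · rintro ⟨U, hU, N, h⟩
      refine ⟨Ψ '' U, hΨ.image_mem_nhds.2 hU, N, ?_⟩
      rintro _ ⟨z, hz, rfl⟩
      refine (h z hz).imp_left ?_
      rintro ⟨γ, hγ, h'⟩
      exact ⟨γ, hγ, (ih γ hγ z).1 h'⟩
    · rintro ⟨U, hU, N, h⟩
      refine ⟨Ψ ⁻¹' U, hΨ.continuous.continuousAt hU, N, fun z hz => (h _ hz).imp_left ?_⟩
      rintro ⟨γ, hγ, h'⟩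
      exact ⟨γ, hγ, (ih γ hγ z).2 h'⟩

theorem weightOrder_le_iff {w : X → ℕ∞} {α : Ordinal.{u}} {x : X} :
    weightOrder w x ≤ α ↔ OrderLE w α x := by
  refine ⟨fun h => ?_, fun h => iInf₂_le α h⟩
  by_contra hα
  have : ((Order.succ α : Ordinal.{u}) : WithTop Ordinal.{u}) ≤ weightOrder w x := by
    refine le_iInf₂ fun γ hγ => WithTop.coe_le_coe.2 (Order.succ_le_of_lt ?_)
    by_contra hle
    exact hα (hγ.mono (not_lt.1 hle))
  exact absurd (WithTop.coe_le_coe.1 (this.trans h)) (not_le.2 (Order.lt_succ α))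

theorem weightRankAt_mono {w w' : X → ℕ∞} (hw : w ≤ w') (x : X) :
    weightRankAt w x ≤ weightRankAt w' x := by
  unfold weightRankAt
  cases h' : weightOrder w' x with
  | top => simp
  | coe α' =>
    have hα' : OrderLE w' α' x := weightOrder_le_iff.1 h'.le
    have hle : weightOrder w x ≤ α' := weightOrder_le_iff.2 (hα'.of_le hw)
    cases h : weightOrder w x with
    | top => simp [h] at hle
    | coe α =>
      rw [h, WithTop.coe_le_coe] at hle
      rw [WithTop.map_coe, WithTop.map_coe, WithTop.coe_le_coe]
      have : (w x).toNat ≤ (w' x).toNat := ENat.toNat_le_toNat (hw x) hα'.ne_top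
      gcongr

theorem weightRank_mono {w w' : X → ℕ∞} (hw : w ≤ w') : weightRank w ≤ weightRank w' :=
  iSup_mono (weightRankAt_mono hw)

theorem Topology.IsOpenEmbedding.weightRankAt_comp {Ψ : Y → X} (hΨ : IsOpenEmbedding Ψ)
    (w : X → ℕ∞) (y : Y) : weightRankAt (w ∘ Ψ) y = weightRankAt w (Ψ y) := by
  simp only [weightRankAt, weightOrder, hΨ.orderLE_comp_iff, Function.comp_apply]

theorem Topology.IsOpenEmbedding.weightRank_comp_le {Ψ : Y → X} (hΨ : IsOpenEmbedding Ψ)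
    (w : X → ℕ∞) : weightRank (w ∘ Ψ) ≤ weightRank w :=
  iSup_le fun y => (hΨ.weightRankAt_comp w y).trans_le (le_iSup (weightRankAt w) (Ψ y))

/-- A point of order greater than `β` is a limit of points of order at least `β` and arbitrarily
large weight, so it forces the supremum of the ranks over the support of `w` up to `ω · (β + 1)`. -/
theorem omega0_mul_succ_le_of_not_orderLE {w : X → ℕ∞} {β : Ordinal.{u}} {x : X}
    (h : ¬ OrderLE w β x) {σ : Ordinal.{u}} (hσ : ∀ y, w y ≠ 0 → weightRankAt w y ≤ σ) :
    Ordinal.omega0 * Order.succ β ≤ σ := by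
  rw [Ordinal.mul_succ, Ordinal.add_le_iff_of_isSuccLimit Ordinal.isSuccLimit_omega0]
  intro n hn
  obtain ⟨N, rfl⟩ := Ordinal.lt_omega0.1 hn
  have h' := mt orderLE_iff.2 h
  push Not at h'
  obtain ⟨y, -, hy, hN⟩ := h' Set.univ Filter.univ_mem N
  have hr := hσ y (ne_bot_of_gt hN)
  unfold weightRankAt at hr
  cases ho : weightOrder w y with
  | top => simp [ho] at hr
  | coe α =>
    have hα : OrderLE w α y := weightOrder_le_iff.1 ho.le
    have hβα : β ≤ α := by
      by_contra hlt
      exact hy α (not_le.1 hlt) hα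
    have hNw : N ≤ (w y).toNat := by
      simpa using ENat.toNat_le_toNat hN.le hα.ne_top
    rw [ho, WithTop.map_coe, WithTop.coe_le_coe] at hr
    refine le_trans ?_ hr
    gcongr

/-- The rank of a weight that vanishes outside an open set is the rank of its restriction to that
open set: a point off the support of `w` of order `α` has rank `ω · α`, which is the supremum of
the `ω · (β + 1)` with `β < α`. -/
theorem Topology.IsOpenEmbedding.weightRank_comp {Ψ : Y → X} (hΨ : IsOpenEmbedding Ψ)
    {w : X → ℕ∞} (hw : ∀ x ∉ Set.range Ψ, w x = 0) : weightRank (w ∘ Ψ) = weightRank w := by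
  refine (hΨ.weightRank_comp_le w).antisymm (iSup_le fun x => ?_)
  have hrange : ∀ y, weightRankAt w (Ψ y) ≤ weightRank (w ∘ Ψ) := fun y =>
    (hΨ.weightRankAt_comp w y).symm.trans_le (le_iSup (weightRankAt (w ∘ Ψ)) y)
  by_cases hx : x ∈ Set.range Ψ
  · obtain ⟨y, rfl⟩ := hx
    exact hrange y
  cases hS : weightRank (w ∘ Ψ) with
  | top => exact le_top
  | coe σ =>
    have hσ : ∀ y, w y ≠ 0 → weightRankAt w y ≤ σ := by
      intro y hy
      obtain ⟨z, rfl⟩ := not_imp_comm.1 (hw y) hy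
      exact (hrange z).trans_eq hS
    -- Hence `x` has order at most `σ / ω`: otherwise `β = σ / ω` would satisfy `β + 1 ≤ β`.
    have key : ∀ β, ¬ OrderLE w β x → Order.succ β ≤ σ / Ordinal.omega0 := fun β hβ =>
      (Ordinal.mul_le_iff_le_div Ordinal.omega0_ne_zero).1 (omega0_mul_succ_le_of_not_orderLE hβ hσ)
    unfold weightRankAt
    cases ho : weightOrder w x with
    | top =>
      have h := key (σ / Ordinal.omega0) fun h => by
        simpa [ho] using weightOrder_le_iff.2 h
      exact absurd h (not_le.2 (Order.lt_succ _))
    | coe α =>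
      rw [WithTop.map_coe, WithTop.coe_le_coe, hw x hx]
      simp only [ENat.toNat_zero, Nat.cast_zero, add_zero]
      rw [Ordinal.mul_le_iff_le_div Ordinal.omega0_ne_zero]
      by_contra hlt
      have h := key (σ / Ordinal.omega0) fun h => by
        have := weightOrder_le_iff.2 h
        rw [ho, WithTop.coe_le_coe] at this
        exact hlt this
      exact absurd h (not_le.2 (Order.lt_succ _))

end Weight

/-! ### The hereditary subalgebra -/

section Hereditary

variable {A : Type u} [NonUnitalCStarAlgebra A]

theorem star_mul_mul_mem_hereditarySubalgebra (x a : A) :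
    star x * a * x ∈ hereditarySubalgebra x :=
  NonUnitalStarSubalgebra.le_topologicalClosure _ ⟨a, rfl⟩

theorem isClosed_hereditarySubalgebra (x : A) : IsClosed (hereditarySubalgebra x : Set A) :=
  NonUnitalStarSubalgebra.isClosed_topologicalClosure _

/-- A closed property of elements of `A` that holds on `x* A x` holds on its closure. -/
theorem hereditarySubalgebra_induction {x : A} {p : A → Prop} (hp : IsClosed {a | p a})
    (h : ∀ a, p (star x * a * x)) {b : A} (hb : b ∈ hereditarySubalgebra x) : p b := by
  have hsub : ((cornerSubalgebra x : NonUnitalStarSubalgebra ℂ A) : Set A) ⊆ {a | p a} := by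
    rintro _ ⟨a, rfl⟩
    exact h a
  exact closure_minimal hsub hp hb

/-- The compression `a ↦ x* a x` of `A` into the hereditary subalgebra generated by `x`. -/
noncomputable def compress (x : A) : A →ₗ[ℂ] hereditarySubalgebra x where
  toFun a := ⟨star x * a * x, star_mul_mul_mem_hereditarySubalgebra x a⟩
  map_add' a b := Subtype.ext (by simp [mul_add, add_mul])
  map_smul' c a := Subtype.ext (by simp [mul_smul_comm, smul_mul_assoc])

@[simp]
theorem coe_compress (x a : A) : (compress x a : A) = star x * a * x := rfl

theorem star_compress (x a : A) : star (compress x a) = compress x (star a) :=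
  Subtype.ext (by simp [mul_assoc])

theorem compress_mul_compress (x a b : A) :
    compress x a * compress x b = compress x (a * x * star x * b) :=
  Subtype.ext (by simp [mul_assoc])

theorem denseRange_compress (x : A) : DenseRange (compress x) := by
  intro b
  rw [Topology.IsInducing.subtypeVal.closure_eq_preimage_closure_image, Set.mem_preimage]
  refine closure_mono ?_ b.2
  rintro _ ⟨a, rfl⟩
  exact ⟨compress x a, ⟨a, rfl⟩, rfl⟩

/-- Positivity passes to the hereditary subalgebra, since it is closed under square roots. -/
theorem exists_compress_eq_star_mul_self [PartialOrder A] [StarOrderedRing A] (x : A) {a : A}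
    (ha : 0 ≤ a) : ∃ s : hereditarySubalgebra x, compress x a = star s * s := by
  have hpos : 0 ≤ star x * a * x := star_left_conjugate_nonneg ha x
  have hcl := isClosed_hereditarySubalgebra x
  have hmem : CFC.sqrt (star x * a * x) ∈ hereditarySubalgebra x := by
    rw [CFC.sqrt_eq_real_sqrt _ hpos]
    exact cfcₙ_mem (𝕜' := ℂ) _ (star_mul_mul_mem_hereditarySubalgebra x a)
  refine ⟨⟨_, hmem⟩, Subtype.ext ?_⟩
  have hsa : star (CFC.sqrt (star x * a * x)) = CFC.sqrt (star x * a * x) :=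
    (CFC.sqrt_nonneg _).isSelfAdjoint.star_eq
  simp [hsa, CFC.sqrt_mul_sqrt_self _ hpos]

end Hereditary

/-! ### Restriction of irreducible representations -/

namespace IrrRep

variable {A : Type u} [NonUnitalCStarAlgebra A]

theorem mul_apply (ρ : IrrRep A) (a b : A) (v : ρ.H) :
    ρ.toHom (a * b) v = ρ.toHom a (ρ.toHom b v) := by
  rw [map_mul]; rfl

theorem inner_apply_left (ρ : IrrRep A) (a : A) (u v : ρ.H) :
    ⟪ρ.toHom a u, v⟫_ℂ = ⟪u, ρ.toHom (star a) v⟫_ℂ := by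
  rw [map_star, ContinuousLinearMap.star_eq_adjoint, ContinuousLinearMap.adjoint_inner_right]

theorem continuous_apply (ρ : IrrRep A) (v : ρ.H) : Continuous fun a => ρ.toHom a v :=
  (ContinuousLinearMap.apply ℂ ρ.H v).continuous.comp (map_continuous ρ.toHom)

/-- Every nonzero vector of an irreducible representation is cyclic. -/
theorem eq_top_of_forall_apply_mem (ρ : IrrRep A) {v : ρ.H} (hv : v ≠ 0) {K : Submodule ℂ ρ.H}
    (hK : IsClosed (K : Set ρ.H)) (h : ∀ a, ρ.toHom a v ∈ K) : K = ⊤ := by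
  let M : Submodule ℂ ρ.H :=
    { carrier := {w | w ∈ K ∧ ∀ a, ρ.toHom a w ∈ K}
      zero_mem' := by simp
      add_mem' := fun hy hz =>
        ⟨K.add_mem hy.1 hz.1, fun a => by rw [map_add]; exact K.add_mem (hy.2 a) (hz.2 a)⟩
      smul_mem' := fun c y hy =>
        ⟨K.smul_mem c hy.1, fun a => by rw [map_smul]; exact K.smul_mem c (hy.2 a)⟩ }
  have hM : IsClosed (M : Set ρ.H) := by
    have : (M : Set ρ.H) = (K : Set ρ.H) ∩ ⋂ a, ρ.toHom a ⁻¹' (K : Set ρ.H) := by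
      ext w
      simp only [Set.mem_inter_iff, Set.mem_iInter]
      exact Iff.rfl
    rw [this]
    exact hK.inter (isClosed_iInter fun a => hK.preimage (ρ.toHom a).continuous)
  have hinv : ∀ a, ∀ w ∈ M, ρ.toHom a w ∈ M := fun a w hw =>
    ⟨hw.2 a, fun c => by rw [← mul_apply]; exact hw.2 _⟩
  have hav : ∀ a, ρ.toHom a v ∈ M := fun a =>
    ⟨h a, fun c => by rw [← mul_apply]; exact h _⟩
  rcases ρ.irreducible M hM hinv with h0 | h1
  · refine absurd (ρ.eq_zero_of_forall fun a => ?_) hv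
    simpa [h0] using hav a
  · exact eq_top_iff.2 fun w _ => (h1 ▸ Submodule.mem_top : w ∈ M).1

theorem ker_le_ker_of_mem_hereditarySubalgebra (ρ : IrrRep A) {x b : A}
    (hb : b ∈ hereditarySubalgebra x) {v : ρ.H} (hv : ρ.toHom x v = 0) : ρ.toHom b v = 0 := by
  refine hereditarySubalgebra_induction (p := fun b => ρ.toHom b v = 0)
    (isClosed_eq (ρ.continuous_apply v) continuous_const) (fun a => ?_) hb
  rw [mul_apply, hv, map_zero]

theorem rankOf_le_of_ker_le (ρ : IrrRep A) {a b : A}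
    (h : ∀ v, ρ.toHom a v = 0 → ρ.toHom b v = 0) : ρ.rankOf b ≤ ρ.rankOf a := by
  refine OrderHomClass.mono Cardinal.toENat ?_
  rw [LinearMap.rank, LinearMap.rank, ← (ρ.toHom b).toLinearMap.quotKerEquivRange.rank_eq,
    ← (ρ.toHom a).toLinearMap.quotKerEquivRange.rank_eq]
  exact LinearMap.rank_le_of_surjective _ (Submodule.factor_surjective (fun v hv => h v hv))

/-- The essential subspace of the restriction of `ρ` to the hereditary subalgebra generated by `x`:
the closure of `ρ(x*) H`, the orthogonal complement of the kernel of `ρ(x)`. -/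
noncomputable def essential (ρ : IrrRep A) (x : A) : Submodule ℂ ρ.H :=
  (ρ.toHom (star x)).range.topologicalClosure

theorem isClosed_essential (ρ : IrrRep A) (x : A) : IsClosed (ρ.essential x : Set ρ.H) :=
  Submodule.isClosed_topologicalClosure _

instance (ρ : IrrRep A) (x : A) : CompleteSpace (ρ.essential x) :=
  (ρ.isClosed_essential x).completeSpace_coe

theorem star_apply_mem_essential (ρ : IrrRep A) (x : A) (v : ρ.H) :
    ρ.toHom (star x) v ∈ ρ.essential x :=
  Submodule.le_topologicalClosure _ ⟨v, rfl⟩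

theorem apply_mem_essential (ρ : IrrRep A) {x b : A} (hb : b ∈ hereditarySubalgebra x) (v : ρ.H) :
    ρ.toHom b v ∈ ρ.essential x := by
  refine hereditarySubalgebra_induction (p := fun b => ρ.toHom b v ∈ ρ.essential x)
    ((ρ.isClosed_essential x).preimage (ρ.continuous_apply v)) (fun a => ?_) hb
  rw [mul_assoc, mul_apply]
  exact ρ.star_apply_mem_essential x _

theorem orthogonal_essential (ρ : IrrRep A) (x : A) :
    (ρ.essential x)ᗮ = (ρ.toHom x).ker := by
  rw [essential, Submodule.orthogonal_closure, ContinuousLinearMap.orthogonal_range, map_star,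
    ContinuousLinearMap.star_eq_adjoint, ContinuousLinearMap.adjoint_adjoint]

/-- The restriction of `ρ` to the hereditary subalgebra generated by `x`, acting on the essential
subspace. -/
noncomputable def restrictHom (ρ : IrrRep A) (x : A) :
    hereditarySubalgebra x →⋆ₙₐ[ℂ] (ρ.essential x →L[ℂ] ρ.essential x) where
  toFun b := (ρ.toHom b ∘L (ρ.essential x).subtypeL).codRestrict _
    fun v => ρ.apply_mem_essential b.2 v
  map_smul' c b := by
    ext v
    simp only [NonUnitalStarSubalgebra.coe_smul, map_smul]
    rfl
  map_zero' := by ext v; simp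
  map_add' b c := by
    ext v
    simp only [NonUnitalStarSubalgebra.coe_add, map_add]
    rfl
  map_mul' b c := by
    ext v
    exact ρ.mul_apply b c v
  map_star' b := by
    rw [ContinuousLinearMap.star_eq_adjoint, ContinuousLinearMap.eq_adjoint_iff]
    intro u v
    exact (ρ.inner_apply_left (star b : hereditarySubalgebra x) u v).trans
      (congrArg (fun a => ⟪(u : ρ.H), ρ.toHom a v⟫_ℂ) (star_star (b : A)))

@[simp]
theorem coe_restrictHom_apply (ρ : IrrRep A) {x : A} (b : hereditarySubalgebra x)
    (v : ρ.essential x) : (ρ.restrictHom x b v : ρ.H) = ρ.toHom b v := rfl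

theorem apply_eq_restrictHom_apply (ρ : IrrRep A) {x : A} (b : hereditarySubalgebra x) (v : ρ.H) :
    ρ.toHom b v = ρ.restrictHom x b ((ρ.essential x).orthogonalProjectionOnto v) := by
  rw [coe_restrictHom_apply, ← sub_eq_zero, ← map_sub]
  refine ρ.ker_le_ker_of_mem_hereditarySubalgebra b.2 ?_
  have := (ρ.essential x).sub_starProjection_mem_orthogonal v
  rw [orthogonal_essential] at this
  exact this

theorem restrictHom_eq_zero_iff (ρ : IrrRep A) {x : A} (b : hereditarySubalgebra x) :
    ρ.restrictHom x b = 0 ↔ ρ.toHom b = 0 := by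
  refine ⟨fun h => ?_, fun h => ?_⟩
  · ext v
    simp [apply_eq_restrictHom_apply, h]
  · ext v
    simp [h]

/-- The irreducible representation of the hereditary subalgebra generated by `x` obtained from an
irreducible representation of the ambient algebra that does not annihilate `x`. -/
noncomputable def restrict (ρ : IrrRep A) {x : A} (hx : ρ.toHom x ≠ 0) :
    IrrRep (hereditarySubalgebra x) where
  H := ρ.essential x
  toHom := ρ.restrictHom x
  nonzero := by
    by_contra! h
    have h' : ∀ a, star x * a * x ∈ ρ.ker := fun a =>
      (ρ.mem_ker _).2 ((ρ.restrictHom_eq_zero_iff _).1 (h (compress x a)))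
    rcases ρ.prime h' with h1 | h1
    · rw [mem_ker, map_star, star_eq_zero] at h1
      exact hx h1
    · exact hx ((ρ.mem_ker _).1 h1)
  irreducible L hL hinv := by
    refine or_iff_not_imp_left.2 fun hne => ?_
    obtain ⟨v, hvL, hv⟩ := L.exists_mem_ne_zero_of_ne_bot hne
    have hxv : ρ.toHom x v ≠ 0 := fun h => by
      have h1 : (v : ρ.H) ∈ (ρ.essential x)ᗮ := by rw [orthogonal_essential]; exact h
      exact hv (Subtype.ext (inner_self_eq_zero.1 (h1 v v.2)))
    -- As `ρ(x) v` is cyclic, the vectors `ρ(x* a x) v` are dense in the essential subspace.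
    let M : Submodule ℂ ρ.H := L.map (ρ.essential x).subtype
    have hM : IsClosed (M : Set ρ.H) :=
      (ρ.isClosed_essential x).isClosedEmbedding_subtypeVal.isClosedMap _ hL
    have htop := ρ.eq_top_of_forall_apply_mem hxv
      (K := M.comap (ρ.toHom (star x)).toLinearMap)
      (hM.preimage (ρ.toHom (star x)).continuous) fun a => by
        refine ⟨_, hinv (compress x a) v hvL, ?_⟩
        simp [mul_assoc]
    have hle : ρ.essential x ≤ M := by
      refine Submodule.topologicalClosure_minimal _ ?_ hM
      rintro _ ⟨w, rfl⟩
      exact (htop ▸ Submodule.mem_top : w ∈ M.comap (ρ.toHom (star x)).toLinearMap)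
    refine eq_top_iff.2 fun w _ => ?_
    obtain ⟨w', hw', h⟩ := hle w.2
    rwa [← Subtype.ext h]

theorem mem_ker_restrict_iff (ρ : IrrRep A) {x : A} (hx : ρ.toHom x ≠ 0)
    {b : hereditarySubalgebra x} : b ∈ (ρ.restrict hx).ker ↔ (b : A) ∈ ρ.ker := by
  rw [mem_ker, mem_ker]
  exact ρ.restrictHom_eq_zero_iff b

theorem rankOf_le_rankOf_restrict (ρ : IrrRep A) {x : A} (hx : ρ.toHom x ≠ 0)
    (b : hereditarySubalgebra x) : ρ.rankOf b ≤ (ρ.restrict hx).rankOf b := by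
  refine OrderHomClass.mono Cardinal.toENat ?_
  have : (ρ.toHom b).toLinearMap = (ρ.essential x).subtype ∘ₗ (ρ.restrictHom x b).toLinearMap ∘ₗ
      (ρ.essential x).orthogonalProjectionOnto.toLinearMap :=
    LinearMap.ext fun v => ρ.apply_eq_restrictHom_apply b v
  rw [this]
  exact (LinearMap.rank_comp_le_right _ _).trans (LinearMap.rank_comp_le_left _ _)

end IrrRep

/-! ### Extension of irreducible representations -/

section GNS

open scoped ComplexOrder

variable {A : Type u} [NonUnitalCStarAlgebra A] [PartialOrder A] [StarOrderedRing A]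

/-- The canonical map from the algebra to the Hilbert space of the GNS construction. -/
noncomputable def PositiveLinearMap.gnsVector (f : A →ₚ[ℂ] ℂ) : A →ₗ[ℂ] f.GNS :=
  (UniformSpace.Completion.toComplL (𝕜 := ℂ) (E := f.PreGNS)).toLinearMap ∘ₗ
    f.toPreGNS.toLinearMap

theorem PositiveLinearMap.denseRange_gnsVector (f : A →ₚ[ℂ] ℂ) : DenseRange f.gnsVector :=
  UniformSpace.Completion.denseRange_coe.comp f.toPreGNS.surjective.denseRange
    (UniformSpace.Completion.continuous_coe _)

theorem PositiveLinearMap.inner_gnsVector (f : A →ₚ[ℂ] ℂ) (a b : A) :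
    ⟪f.gnsVector a, f.gnsVector b⟫_ℂ = f (star a * b) :=
  UniformSpace.Completion.inner_coe (𝕜 := ℂ) _ _

theorem PositiveLinearMap.gnsNonUnitalStarAlgHom_gnsVector (f : A →ₚ[ℂ] ℂ) (a b : A) :
    f.gnsNonUnitalStarAlgHom a (f.gnsVector b) = f.gnsVector (a * b) :=
  f.gnsNonUnitalStarAlgHom_apply_coe

end GNS

namespace IrrRep

variable {A : Type u} [NonUnitalCStarAlgebra A] {x : A}

/-- For a nonzero vector `ξ`, the vectors `σ(x* a x) ξ` are dense. -/
theorem denseRange_compress_apply (σ : IrrRep (hereditarySubalgebra x)) {ξ : σ.H} (hξ : ξ ≠ 0) :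
    DenseRange fun a => σ.toHom (compress x a) ξ := by
  let e : A →ₗ[ℂ] σ.H :=
    { toFun := fun a => σ.toHom (compress x a) ξ
      map_add' := by simp
      map_smul' := by simp }
  have htop : e.range.topologicalClosure = ⊤ := by
    refine σ.eq_top_of_forall_apply_mem hξ (Submodule.isClosed_topologicalClosure _) fun b => ?_
    refine (denseRange_compress x).induction_on b ?_ fun a => ?_
    · exact (Submodule.isClosed_topologicalClosure _).preimage (σ.continuous_apply ξ)
    · exact Submodule.le_topologicalClosure _ ⟨a, rfl⟩
  exact (Submodule.dense_iff_topologicalClosure_eq_top).2 htop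

open scoped ComplexOrder in
/-- The positive functional `a ↦ ⟪ξ, σ(x* a x) ξ⟫`. -/
noncomputable def inducedFunctional [PartialOrder A] [StarOrderedRing A]
    (σ : IrrRep (hereditarySubalgebra x)) (ξ : σ.H) : A →ₚ[ℂ] ℂ :=
  PositiveLinearMap.mk₀
    { toFun := fun a => ⟪ξ, σ.toHom (compress x a) ξ⟫_ℂ
      map_add' := by simp
      map_smul' := by simp }
    (by
      intro a ha
      obtain ⟨s, hs⟩ := exists_compress_eq_star_mul_self x ha
      have : ⟪ξ, σ.toHom (compress x a) ξ⟫_ℂ = ⟪σ.toHom s ξ, σ.toHom s ξ⟫_ℂ := by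
        rw [hs, mul_apply, inner_apply_left]
      rw [LinearMap.coe_mk, AddHom.coe_mk, this]
      exact RCLike.nonneg_iff.2 ⟨inner_self_nonneg, inner_self_im _⟩)

open scoped ComplexOrder in
/-- Every irreducible representation `σ` of the hereditary subalgebra generated by `x` is the
restriction of an irreducible representation `ρ` of the ambient algebra to a subspace that contains
the range of `ρ(x*)`. -/
theorem exists_extension (σ : IrrRep (hereditarySubalgebra x)) :
    ∃ (ρ : IrrRep A) (W : σ.H →L[ℂ] ρ.H), Function.Injective W ∧
      (∀ b v, W (σ.toHom b v) = ρ.toHom b (W v)) ∧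
      ∀ v, ρ.toHom (star x) v ∈ W.range := by
  let _ := CStarAlgebra.spectralOrder A
  have _ := CStarAlgebra.spectralOrderedRing A
  obtain ⟨ξ, hξ⟩ : ∃ ξ : σ.H, ξ ≠ 0 := by
    by_contra! h
    obtain ⟨b, hb⟩ := σ.nonzero
    exact hb (ContinuousLinearMap.ext fun v => by rw [h v, map_zero, map_zero])
  let f := σ.inducedFunctional ξ
  have hfa : ∀ a, f a = ⟪ξ, σ.toHom (compress x a) ξ⟫_ℂ := fun a => rfl
  let Λ : A →ₗ[ℂ] f.GNS := f.gnsVector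
  have hΛ : DenseRange Λ := f.denseRange_gnsVector
  let π := f.gnsNonUnitalStarAlgHom
  have hπΛ : ∀ a b, π a (Λ b) = Λ (a * b) := f.gnsNonUnitalStarAlgHom_gnsVector
  have hπadj : ∀ a u v, ⟪π a u, v⟫_ℂ = ⟪u, π (star a) v⟫_ℂ := fun a u v => by
    rw [map_star, ContinuousLinearMap.star_eq_adjoint, ContinuousLinearMap.adjoint_inner_right]
  have hπmul : ∀ a b v, π (a * b) v = π a (π b v) := fun a b v => by rw [map_mul]; rfl
  have hπcont : ∀ v, Continuous fun a => π a v := fun v =>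
    (ContinuousLinearMap.apply ℂ f.GNS v).continuous.comp (map_continuous π)
  let e : A →ₗ[ℂ] σ.H :=
    { toFun := fun a => σ.toHom (compress x a) ξ
      map_add' := by simp
      map_smul' := by simp }
  have he : DenseRange e := σ.denseRange_compress_apply hξ
  have hea : ∀ a, e a = σ.toHom (compress x a) ξ := fun a => rfl
  -- The isometry `W` identifies `σ(x* a x) ξ` with `π(x*) Λ(a)`.
  let g : A →ₗ[ℂ] f.GNS := (π (star x)).toLinearMap ∘ₗ Λ
  have hg : ∀ a, g a = Λ (star x * a) := fun a => hπΛ _ _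
  have hinner : ∀ a b, ⟪g a, g b⟫_ℂ = ⟪e a, e b⟫_ℂ := fun a b => by
    rw [hg, hg, f.inner_gnsVector, hfa, hea, hea, inner_apply_left, ← mul_apply, star_compress,
      compress_mul_compress]
    simp [mul_assoc]
  have hnorm : ∀ a, ‖g a‖ = ‖e a‖ := fun a => by
    rw [@norm_eq_sqrt_re_inner ℂ, @norm_eq_sqrt_re_inner ℂ, hinner]
  let W : σ.H →L[ℂ] f.GNS := g.extendOfNorm e
  have hW : ∀ a, W (e a) = g a :=
    LinearMap.extendOfNorm_eq he ⟨1, fun a => by rw [hnorm, one_mul]⟩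
  have hWiso : Isometry W := by
    refine AddMonoidHomClass.isometry_of_norm W fun v => ?_
    induction v using he.induction_on with
    | hp => exact isClosed_eq (by fun_prop) (by fun_prop)
    | ih a => rw [hW, hnorm]
  have hWinner : ∀ u v, ⟪W u, W v⟫_ℂ = ⟪u, v⟫_ℂ := fun u v =>
    (⟨W.toLinearMap, fun v => hWiso.norm_map_of_map_zero (map_zero W) v⟩ :
      σ.H →ₗᵢ[ℂ] f.GNS).inner_map_map u v
  have hWint : ∀ b v, W (σ.toHom b v) = π b (W v) := by
    have hcomp : ∀ a v, W (σ.toHom (compress x a) v) = π (compress x a : A) (W v) := by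
      intro a v
      induction v using he.induction_on with
      | hp => exact isClosed_eq (by fun_prop) (by fun_prop)
      | ih c =>
        have : σ.toHom (compress x a) (e c) = e (a * x * star x * c) := by
          rw [hea, hea, ← mul_apply, compress_mul_compress]
        rw [this, hW, hW, hg, hg, hπΛ, coe_compress]
        simp only [mul_assoc]
    intro b v
    refine (denseRange_compress x).induction_on b ?_ fun a => hcomp a v
    exact isClosed_eq (W.continuous.comp (σ.continuous_apply v))
      ((hπcont _).comp continuous_subtype_val)
  have hWclosed : IsClosed (W.range : Set f.GNS) := hWiso.isClosedEmbedding.isClosed_range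
  have hrange : ∀ v, π (star x) v ∈ W.range := by
    intro v
    induction v using hΛ.induction_on with
    | hp => exact hWclosed.preimage (π (star x)).continuous
    | ih a => exact ⟨e a, hW a⟩
  -- The vector `W ξ` is the cyclic vector: `Λ(a) = π(a) π(x) W ξ`.
  have hcyc : ∀ a, Λ a = π (a * x) (W ξ) := by
    intro a
    refine hΛ.eq_of_inner_right ℂ fun c => ?_
    have h1 : ⟪Λ c, π (a * x) (W ξ)⟫_ℂ = ⟪π (star (a * x)) (Λ c), W ξ⟫_ℂ := by
      rw [hπadj, star_star]
    have h2 : π (star (a * x)) (Λ c) = W (e (star a * c)) := by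
      rw [hπΛ, hW, hg, star_mul, mul_assoc]
    rw [h1, h2, hWinner, hea, inner_apply_left, star_compress, star_mul, star_star]
    exact f.inner_gnsVector c a
  have hnz : ∃ a, π a ≠ 0 := by
    by_contra! h
    obtain ⟨b, hb⟩ := σ.nonzero
    refine hb (ContinuousLinearMap.ext fun v => hWiso.injective ?_)
    rw [hWint, h]
    exact (map_zero W).symm
  refine ⟨⟨f.GNS, π, hnz, fun K hK hinv => ?_⟩, W, hWiso.injective, hWint, hrange⟩
  have hinv' := σ.irreducible (K.comap W.toLinearMap) (hK.preimage W.continuous) fun b v hv => by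
    change W _ ∈ K
    rw [hWint]
    exact hinv _ _ hv
  rcases hinv' with h | h
  · -- Then `π(x*) K = 0`, so `K` is orthogonal to every `Λ(a) = π(a) π(x) W ξ`.
    left
    have hx : ∀ v ∈ K, π (star x) v = 0 := fun v hv => by
      obtain ⟨u, hu⟩ := hrange v
      have hu0 : u ∈ K.comap W.toLinearMap := by
        change W u ∈ K
        exact hu ▸ hinv _ _ hv
      rw [h, Submodule.mem_bot] at hu0
      rw [← hu, hu0]; exact map_zero W
    refine (Submodule.eq_bot_iff _).2 fun v hv => ?_
    refine hΛ.eq_zero_of_inner_left ℂ fun a => ?_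
    rw [hcyc, ← star_star (a * x), ← hπadj, star_mul, hπmul, hx _ (hinv _ _ hv), inner_zero_left]
  · right
    refine Submodule.eq_top_iff'.2 fun v => ?_
    induction v using hΛ.induction_on with
    | hp => exact hK
    | ih a =>
      rw [hcyc]
      exact hinv _ _ (h ▸ Submodule.mem_top : ξ ∈ K.comap W.toLinearMap)

/-- The extension of `σ` provided by `exists_extension` has the same kernel as `σ` on the hereditary
subalgebra, and the ranks of the operators do not decrease. -/
theorem exists_extension_rankOf_le (σ : IrrRep (hereditarySubalgebra x)) :
    ∃ ρ : IrrRep A, (∀ b : hereditarySubalgebra x, b ∈ σ.ker ↔ (b : A) ∈ ρ.ker) ∧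
      ∀ b : hereditarySubalgebra x, σ.rankOf b ≤ ρ.rankOf (b : A) := by
  obtain ⟨ρ, W, hinj, hint, hrange⟩ := σ.exists_extension
  refine ⟨ρ, fun b => ?_, fun b => OrderHomClass.mono Cardinal.toENat ?_⟩
  · rw [mem_ker, mem_ker]
    refine ⟨fun h => ?_, fun h => ?_⟩
    · -- `ρ(b)` vanishes on the range of `W`, which contains the range of `ρ(b*)`.
      have h0 : ∀ v, ρ.toHom (star x) v ∈ W.range → ρ.toHom ((b : A) * star x) v = 0 := by
        rintro v ⟨w, hw⟩
        rw [mul_apply, ← hw]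
        exact (hint b w).symm.trans (by rw [h]; exact map_zero W)
      have h1 : ρ.toHom ((b : A) * star (b : A)) = 0 := by
        refine hereditarySubalgebra_induction (p := fun c => ρ.toHom ((b : A) * c) = 0)
          (isClosed_eq ((map_continuous ρ.toHom).comp (continuous_const_mul _)) continuous_const)
          (fun a => ?_) (star_mem b.2)
        ext v
        rw [← mul_assoc, ← mul_assoc, mul_assoc, mul_apply]
        exact h0 _ (hrange _)
      rwa [map_mul, map_star, CStarRing.mul_star_self_eq_zero_iff] at h1
    · ext v
      refine hinj ?_
      rw [hint, h]
      exact (map_zero W).symm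
  · have : (ρ.toHom b).toLinearMap ∘ₗ W.toLinearMap = W.toLinearMap ∘ₗ (σ.toHom b).toLinearMap :=
      LinearMap.ext fun v => (hint b v).symm
    have hrank : LinearMap.rank (W.toLinearMap ∘ₗ (σ.toHom b).toLinearMap) =
        LinearMap.rank (σ.toHom b).toLinearMap := by
      rw [LinearMap.rank, LinearMap.range_comp]
      exact LinearEquiv.rank_eq (Submodule.equivMapOfInjective W.toLinearMap hinj _).symm
    rw [← hrank, ← this]
    exact LinearMap.rank_comp_le_left _ _

end IrrRep

/-! ### The primitive spectrum of the hereditary subalgebra -/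

namespace PrimSpec

variable {A : Type u} [NonUnitalCStarAlgebra A] {x : A}

theorem isClosed_iff_exists_hull {C : Set (PrimSpec A)} :
    IsClosed C ↔ ∃ I : TwoSidedIdeal A, C = hull I := by
  rw [← isOpen_compl_iff]
  change Cᶜᶜ ∈ {C | ∃ I : TwoSidedIdeal A, C = hull I} ↔ _
  rw [compl_compl, Set.mem_ofPred_eq]

theorem isClosed_hull (I : TwoSidedIdeal A) : IsClosed (hull I) :=
  isClosed_iff_exists_hull.2 ⟨I, rfl⟩

/-- The kernel of an extension of `σ` meets the hereditary subalgebra in the kernel of `σ`. -/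
theorem exists_forall_mem_iff (Q : PrimSpec (hereditarySubalgebra x)) :
    ∃ P : PrimSpec A, ∀ b : hereditarySubalgebra x, b ∈ Q.1 ↔ (b : A) ∈ P.1 := by
  obtain ⟨σ, hσ⟩ := Q.2
  obtain ⟨ρ, hker, -⟩ := σ.exists_extension_rankOf_le
  exact ⟨⟨ρ.ker, ρ, rfl⟩, fun b => by rw [← hσ]; exact hker b⟩

/-- The primitive ideal of the ambient algebra that restricts to a given primitive ideal of the
hereditary subalgebra generated by `x`. -/
noncomputable def extend (Q : PrimSpec (hereditarySubalgebra x)) : PrimSpec A :=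
  (exists_forall_mem_iff Q).choose

theorem coe_mem_extend_iff {Q : PrimSpec (hereditarySubalgebra x)} {b : hereditarySubalgebra x} :
    (b : A) ∈ (extend Q).1 ↔ b ∈ Q.1 :=
  ((exists_forall_mem_iff Q).choose_spec b).symm

theorem notMem_extend (Q : PrimSpec (hereditarySubalgebra x)) : x ∉ (extend Q).1 := by
  intro hx
  obtain ⟨σ, hσ⟩ := Q.2
  obtain ⟨b, hb⟩ := σ.nonzero
  refine hb ?_
  refine (denseRange_compress x).induction_on b
    (isClosed_eq (map_continuous σ.toHom) continuous_const) fun a => ?_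
  rw [← σ.mem_ker, hσ, ← coe_mem_extend_iff, coe_compress]
  exact (extend Q).1.mul_mem_left _ _ hx

/-- A primitive ideal that does not contain `x` is determined by its intersection with `x* A x`. -/
theorem mem_of_forall_mem {P : PrimSpec A} (hx : x ∉ P.1) {a : A}
    (h : ∀ c d, star x * (c * a * d) * x ∈ P.1) : a ∈ P.1 := by
  obtain ⟨ρ, hρ⟩ := P.2
  rw [← hρ] at hx h ⊢
  have hsx : star x ∉ ρ.ker := by
    rwa [IrrRep.mem_ker, map_star, star_eq_zero, ← IrrRep.mem_ker]
  have h1 : ∀ d, a * d * x ∈ ρ.ker := fun d =>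
    (ρ.prime fun c => by simpa only [mul_assoc] using h c d).resolve_left hsx
  exact (ρ.prime h1).resolve_right hx

theorem le_extend_iff {Q : PrimSpec (hereditarySubalgebra x)} {I : TwoSidedIdeal A} :
    I ≤ (extend Q).1 ↔ ∀ b : hereditarySubalgebra x, (b : A) ∈ I → b ∈ Q.1 := by
  refine ⟨fun h b hb => coe_mem_extend_iff.1 (h hb), fun h a ha => ?_⟩
  refine mem_of_forall_mem (notMem_extend Q) fun c d => ?_
  refine coe_mem_extend_iff.2 (h (compress x (c * a * d)) ?_)
  exact I.mul_mem_right _ _ (I.mul_mem_left _ _ (I.mul_mem_right _ _ (I.mul_mem_left _ _ ha)))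

theorem eq_extend {P : PrimSpec A} (hx : x ∉ P.1) {Q : PrimSpec (hereditarySubalgebra x)}
    (h : ∀ b : hereditarySubalgebra x, b ∈ Q.1 ↔ (b : A) ∈ P.1) : P = extend Q := by
  refine Subtype.ext (le_antisymm (le_extend_iff.2 fun b => (h b).2) fun a ha => ?_)
  refine mem_of_forall_mem hx fun c d => ?_
  refine (h (compress x (c * a * d))).1 (le_extend_iff.1 le_rfl _ ?_)
  exact TwoSidedIdeal.mul_mem_right _ _ _ (TwoSidedIdeal.mul_mem_left _ _ _
    (TwoSidedIdeal.mul_mem_right _ _ _ (TwoSidedIdeal.mul_mem_left _ _ _ ha)))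

theorem extend_injective :
    Function.Injective (extend : PrimSpec (hereditarySubalgebra x) → PrimSpec A) := by
  intro Q Q' h
  refine Subtype.ext (SetLike.ext fun b => ?_)
  rw [← coe_mem_extend_iff, h, coe_mem_extend_iff]

theorem range_extend :
    Set.range (extend : PrimSpec (hereditarySubalgebra x) → PrimSpec A) = {P | x ∉ P.1} := by
  ext P
  constructor
  · rintro ⟨Q, rfl⟩
    exact notMem_extend Q
  · intro hx
    obtain ⟨ρ, hρ⟩ := P.2
    have hx' : ρ.toHom x ≠ 0 := fun h => hx (hρ ▸ (ρ.mem_ker x).2 h)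
    refine ⟨⟨(ρ.restrict hx').ker, _, rfl⟩, (eq_extend hx fun b => ?_).symm⟩
    rw [← hρ]
    exact ρ.mem_ker_restrict_iff hx'

theorem isOpenEmbedding_extend :
    Topology.IsOpenEmbedding (extend : PrimSpec (hereditarySubalgebra x) → PrimSpec A) := by
  refine .of_continuous_injective_isOpenMap ?_ extend_injective ?_
  · refine continuous_iff_isClosed.2 fun C hC => ?_
    obtain ⟨I, rfl⟩ := isClosed_iff_exists_hull.1 hC
    refine isClosed_iff_exists_hull.2
      ⟨I.comap (NonUnitalStarSubalgebraClass.subtype (hereditarySubalgebra x)), ?_⟩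
    ext Q
    refine le_extend_iff.trans (forall_congr' fun b => ?_)
    rw [TwoSidedIdeal.mem_comap]
    exact Iff.rfl
  · intro U hU
    obtain ⟨J, hJ⟩ := isClosed_iff_exists_hull.1 hU.isClosed_compl
    have hmem : ∀ Q, Q ∈ U ↔ ¬ J ≤ Q.1 := fun Q => by
      rw [← not_iff_not, not_not]
      exact Set.ext_iff.1 hJ Q
    have himage : extend '' U = (hull (TwoSidedIdeal.span {x}) ∪
        hull (TwoSidedIdeal.span ((↑) '' (J : Set (hereditarySubalgebra x)))))ᶜ := by
      have hJle : ∀ Q : PrimSpec (hereditarySubalgebra x),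
          extend Q ∈ hull (TwoSidedIdeal.span ((↑) '' (J : Set (hereditarySubalgebra x)))) ↔
            J ≤ Q.1 := by
        intro Q
        refine TwoSidedIdeal.span_le.trans (Set.image_subset_iff.trans ?_)
        exact forall₂_congr fun b _ => coe_mem_extend_iff
      have hxle : ∀ P : PrimSpec A, P ∈ hull (TwoSidedIdeal.span {x}) ↔ x ∈ P.1 := fun P =>
        TwoSidedIdeal.span_le.trans Set.singleton_subset_iff
      ext P
      rw [Set.mem_compl_iff, Set.mem_union, not_or, hxle]
      constructor
      · rintro ⟨Q, hQ, rfl⟩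
        exact ⟨notMem_extend Q, (hJle Q).not.2 ((hmem Q).1 hQ)⟩
      · rintro ⟨hx, hP⟩
        obtain ⟨Q, rfl⟩ := range_extend.symm.subset hx
        exact ⟨Q, (hmem Q).2 ((hJle Q).not.1 hP), rfl⟩
    rw [himage]
    exact ((isClosed_hull _).union (isClosed_hull _)).isOpen_compl

end PrimSpec

/-! ### Comparison of the Pedersen functions -/

section Pedersen

variable {A : Type u} [NonUnitalCStarAlgebra A] {x : A}

theorem pedersenFunction_eq_zero {a : A} {P : PrimSpec A} (ha : a ∈ P.1) :
    pedersenFunction a P = 0 := by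
  refine le_antisymm (iSup₂_le fun ρ hρ => ?_) zero_le
  rw [← hρ, ρ.mem_ker] at ha
  simp [IrrRep.rankOf, ha]

theorem pedersenFunction_le_of_ker_le {a b : A}
    (h : ∀ (ρ : IrrRep A) v, ρ.toHom a v = 0 → ρ.toHom b v = 0) :
    pedersenFunction b ≤ pedersenFunction a := fun _ =>
  iSup₂_mono fun ρ _ => ρ.rankOf_le_of_ker_le (h ρ)

theorem pedersenFunction_coe_comp_extend (b : hereditarySubalgebra x) :
    pedersenFunction (b : A) ∘ PrimSpec.extend = pedersenFunction b := by
  ext1 Q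
  refine le_antisymm (iSup₂_le fun ρ hρ => ?_) (iSup₂_le fun σ hσ => ?_)
  · have hx : ρ.toHom x ≠ 0 := by
      rw [Ne, ← ρ.mem_ker, hρ]
      exact PrimSpec.notMem_extend Q
    have hker : (ρ.restrict hx).ker = Q.1 := SetLike.ext fun c => by
      rw [ρ.mem_ker_restrict_iff hx, hρ, PrimSpec.coe_mem_extend_iff]
    exact (ρ.rankOf_le_rankOf_restrict hx b).trans
      (le_iSup₂_of_le (ρ.restrict hx) hker le_rfl)
  · obtain ⟨ρ, hker, hrank⟩ := σ.exists_extension_rankOf_le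
    have hx : x ∉ ρ.ker := fun hx => by
      obtain ⟨c, hc⟩ := σ.nonzero
      refine hc ((σ.mem_ker c).1 ((hker c).2 ?_))
      rw [ρ.mem_ker] at hx ⊢
      exact ContinuousLinearMap.ext fun v =>
        ρ.ker_le_ker_of_mem_hereditarySubalgebra c.2 (by rw [hx]; rfl)
    have hP := PrimSpec.eq_extend (P := ⟨ρ.ker, ρ, rfl⟩) hx (Q := Q) fun c => by
      rw [← hσ]; exact hker c
    exact (hrank b).trans (le_iSup₂_of_le ρ (congrArg Subtype.val hP) le_rfl)

theorem pedersenFunction_coe_le (b : hereditarySubalgebra x) :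
    pedersenFunction (b : A) ≤ pedersenFunction x :=
  pedersenFunction_le_of_ker_le fun ρ _ => ρ.ker_le_ker_of_mem_hereditarySubalgebra b.2

/-- The element `(x* x)²` of the hereditary subalgebra has the same kernel as `x` in every
representation, hence the same Pedersen function. -/
theorem pedersenFunction_compress_mul_star (x : A) :
    pedersenFunction (compress x (x * star x) : A) = pedersenFunction x := by
  refine (pedersenFunction_coe_le _).antisymm (pedersenFunction_le_of_ker_le fun ρ v hv => ?_)
  have h : ∀ w, ρ.toHom (star x * x) w = 0 → ρ.toHom x w = 0 := fun w hw => by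
    rw [← inner_self_eq_zero (𝕜 := ℂ), ρ.inner_apply_left, ← ρ.mul_apply, hw, inner_zero_right]
  refine h v ?_
  rw [← inner_self_eq_zero (𝕜 := ℂ), ρ.inner_apply_left, ← ρ.mul_apply, star_mul, star_star]
  rw [coe_compress] at hv
  have : star x * x * (star x * x) = star x * (x * star x) * x := by simp only [mul_assoc]
  rw [this, hv, inner_zero_right]

end Pedersen

theorem mainTheorem7 {A : Type u} [NonUnitalCStarAlgebra A] [TopologicalSpace.SeparableSpace A]
    (x : A) :
    elementPedersenRank x = algebraPedersenRank (hereditarySubalgebra x) := by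
  have hvanish : ∀ P ∉ Set.range (PrimSpec.extend (x := x)), pedersenFunction x P = 0 := by
    intro P hP
    rw [PrimSpec.range_extend, Set.mem_ofPred_eq, not_not] at hP
    exact pedersenFunction_eq_zero hP
  refine le_antisymm ?_ (iSup_le fun b => ?_)
  · refine le_iSup_of_le (compress x (x * star x)) ?_
    unfold elementPedersenRank
    rw [← pedersenFunction_coe_comp_extend, pedersenFunction_compress_mul_star,
      PrimSpec.isOpenEmbedding_extend.weightRank_comp hvanish]
  · unfold elementPedersenRank
    rw [← pedersenFunction_coe_comp_extend]
    exact (PrimSpec.isOpenEmbedding_extend.weightRank_comp_le _).trans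
      (weightRank_mono (pedersenFunction_coe_le b))
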